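/- **The game.** Fix a number of rounds $n$. A buyer has a private value $v\in[0,1]$, drawn once from a distribution $F$ known to the seller and the same in all rounds. In each round the seller posts a price $p\ge 0$ for a fresh item (production cost $0$) and the buyer then accepts or rejects. *Partial commitment*: the seller may never post a price larger than a price that the buyer has accepted in an earlier round; he may lower prices. The buyer's utility is the sum of $v-p$ over the rounds in which he accepts, the seller's utility is the sum of the accepted prices; there is no discounting. A history consists of all past prices and responses and satisfies the above constraints. A seller strategy $\sigma_s$ assigns (measurably) to every history a probability distribution over the allowed prices; a buyer strategy $\sigma_b$ assigns (measurably) to every value $v$, history $h$ and newly posted price $p$ a probability of acceptance. A belief system $\mu$ assigns to every history a probability distribution on $[0,1]$, the seller's belief about $v$; it does not change when the seller posts a price. **Perfect Bayesian equilibrium (PBE).** $(\sigma_s,\sigma_b,\mu)$ is a PBE if 1. the initial belief is $F$, and after every history $h$, every allowed price $p$ and every response to $p$ that has positive probability under $\mu(\cdot\mid h)$ and $\sigma_b$, the new belief is obtained from $\mu(\cdot\mid h)$ by Bayes' rule (after responses of probability zero the new belief is unrestricted); 2. after every history, both at the beginning of a round and after a price has been posted, $\sigma_s$ maximizes the seller's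 expected utility from then on against $\sigma_b$, with $v$ distributed according to the current belief, among all seller strategies; and for every value $v\in[0,1]$, $\sigma_b$ maximizes the expected utility from then on of the buyer of value $v$ against $\sigma_s$, among all buyer strategies. It is a *threshold* PBE if there is a deterministic threshold $t(h,p)\ge 0$ for every history $h$ and allowed price $p$ such that under $\sigma_b$ the buyer of value $v$ accepts $p$ after $h$ if $v\ge t(h,p)$ and rejects otherwise. **Theorem.** For every integer $k\ge 0$ and every number of rounds $n$, the $n$-round partial commitment repeated sales game in which the buyer's value has density $f(x)=(k+1)x^k$ on $[0,1]$ has a threshold PBE. -/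

import Mathlib

open MeasureTheory ProbabilityTheory
open scoped ENNReal

noncomputable section

namespace RepeatedSales

/-- A history of `r` completed rounds. Entry `i` is the price posted in round `i` together with
the buyer's response (`true` = accept, `false` = reject). -/
abbrev Hist (r : ℕ) : Type := Fin r → ℝ × Bool

/-- Append one more round (posted price and response) to a history. -/
def Hist.extend {r : ℕ} (h : Hist r) (p : ℝ) (a : Bool) : Hist (r + 1) :=
  Fin.snoc (α := fun _ => ℝ × Bool) h (p, a)

/-- The prices the seller may post after history `h`: nonnegative prices which, by the partial
commitment, do not exceed any price that the buyer has accepted so far. -/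
def Hist.allowed {r : ℕ} (h : Hist r) : Set ℝ :=
  {p | 0 ≤ p ∧ ∀ j, (h j).2 = true → p ≤ (h j).1}

/-- `h` is a history of the partial commitment game: every price in it was allowed when it
was posted. -/
def Hist.Feasible {r : ℕ} (h : Hist r) : Prop :=
  ∀ i, 0 ≤ (h i).1 ∧ ∀ j, j < i → (h j).2 = true → (h i).1 ≤ (h j).1

/-- The set of possible private values of the buyer. -/
def valueSpace : Set ℝ := Set.Icc 0 1

/-- The power law distribution on `[0,1]` with density `(k + 1) x ^ k`. -/
def powerLaw (k : ℕ) : Measure ℝ :=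
  (volume.restrict (Set.Icc 0 1)).withDensity fun x => ENNReal.ofReal ((k + 1) * x ^ k)

/-- A (behavioral) strategy of the seller: after every history, a probability distribution over
the allowed prices, depending measurably on the history. -/
structure SellerStrategy where
  price : ∀ r : ℕ, Kernel (Hist r) ℝ
  isMarkov : ∀ r, IsMarkovKernel (price r)
  allowed : ∀ r (h : Hist r), h.Feasible → ∀ᵐ p ∂(price r h), p ∈ h.allowed

/-- A (behavioral) strategy of the buyer: `accept r v h p` is the probability with which a buyer
of value `v` accepts the price `p` posted after the history `h` of `r` rounds. -/
structure BuyerStrategy where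
  accept : ∀ r : ℕ, ℝ → Hist r → ℝ → ℝ≥0∞
  accept_le_one : ∀ r v h p, accept r v h p ≤ 1
  measurable_accept : ∀ r,
    Measurable fun x : ℝ × Hist r × ℝ => accept r x.1 x.2.1 x.2.2

/-- Probability that a buyer of value `v` responds with `a` to the price `p`. -/
def BuyerStrategy.respond (b : BuyerStrategy) (r : ℕ) (v : ℝ) (h : Hist r) (p : ℝ) :
    Bool → ℝ≥0∞
  | true => b.accept r v h p
  | false => 1 - b.accept r v h p

/-- Expectation of the sum of `g (price)` over those of the next `m` rounds in which the buyer
accepts, when the history so far is `h`, the buyer has value `v`, and the play follows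
`(s, b)`. -/
def expTotal (g : ℝ → ℝ≥0∞) (s : SellerStrategy) (b : BuyerStrategy) (v : ℝ) :
    (m r : ℕ) → Hist r → ℝ≥0∞
  | 0, _, _ => 0
  | m + 1, r, h =>
    ∫⁻ p, (b.respond r v h p true * (g p + expTotal g s b v m (r + 1) (h.extend p true))
      + b.respond r v h p false * expTotal g s b v m (r + 1) (h.extend p false)) ∂(s.price r h)

/-- The same expectation when the current price `p` has already been posted, the buyer is about
to respond, and `m` further rounds follow the current one. -/
def expTotalAt (g : ℝ → ℝ≥0∞) (s : SellerStrategy) (b : BuyerStrategy) (v : ℝ)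
    (m r : ℕ) (h : Hist r) (p : ℝ) : ℝ≥0∞ :=
  b.respond r v h p true * (g p + expTotal g s b v m (r + 1) (h.extend p true))
    + b.respond r v h p false * expTotal g s b v m (r + 1) (h.extend p false)

/-- The seller's expected utility (revenue) from the remaining `m` rounds after history `h`,
when his belief about the buyer's value is `μ`. -/
def sellerUtility (s : SellerStrategy) (b : BuyerStrategy) (μ : Measure ℝ)
    (m r : ℕ) (h : Hist r) : ℝ≥0∞ :=
  ∫⁻ v, expTotal ENNReal.ofReal s b v m r h ∂μ

/-- The seller's expected utility from the current round, in which `p` has just been posted,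
and the `m` rounds following it. -/
def sellerUtilityAt (s : SellerStrategy) (b : BuyerStrategy) (μ : Measure ℝ)
    (m r : ℕ) (h : Hist r) (p : ℝ) : ℝ≥0∞ :=
  ∫⁻ v, expTotalAt ENNReal.ofReal s b v m r h p ∂μ

/-- The expected utility of a buyer of value `v ≥ 0` from the remaining `m` rounds after history
`h`: `v` times the expected number of purchases minus the expected payment. The former is finite,
so the difference is a genuine element of `[-∞, ∞)`. -/
def buyerUtility (s : SellerStrategy) (b : BuyerStrategy) (v : ℝ)
    (m r : ℕ) (h : Hist r) : EReal :=
  ((ENNReal.ofReal v * expTotal (fun _ => 1) s b v m r h : ℝ≥0∞) : EReal)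
    - (expTotal ENNReal.ofReal s b v m r h : EReal)

/-- The expected utility of a buyer of value `v ≥ 0` from the current round, in which `p` has
just been posted, and the `m` rounds following it. -/
def buyerUtilityAt (s : SellerStrategy) (b : BuyerStrategy) (v : ℝ)
    (m r : ℕ) (h : Hist r) (p : ℝ) : EReal :=
  ((ENNReal.ofReal v * expTotalAt (fun _ => 1) s b v m r h p : ℝ≥0∞) : EReal)
    - (expTotalAt ENNReal.ofReal s b v m r h p : EReal)

/-- `(s, b)` with the seller's beliefs `μ` is a perfect Bayesian equilibrium of the `n` rounds
partial commitment repeated sales game in which the buyer's value is drawn from `F`. The seller's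
belief after `h` is `μ r h`; it does not change when he posts a price himself. -/
structure IsPBE (n : ℕ) (F : Measure ℝ) (s : SellerStrategy) (b : BuyerStrategy)
    (μ : ∀ r : ℕ, Hist r → Measure ℝ) : Prop where
  /-- Beliefs are probability distributions over the possible values. -/
  belief_prob : ∀ r ≤ n, ∀ h : Hist r, h.Feasible → IsProbabilityMeasure (μ r h)
  belief_support : ∀ r ≤ n, ∀ h : Hist r, h.Feasible → ∀ᵐ v ∂(μ r h), v ∈ valueSpace
  /-- Before the first round the belief is the prior. -/
  prior : ∀ h : Hist 0, μ 0 h = F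
  /-- Bayes' rule after the response `a` to any price `p`, on or off the path of play. It says
  nothing when the response has probability zero under the current belief. -/
  bayes : ∀ r < n, ∀ h : Hist r, h.Feasible → ∀ p ∈ h.allowed, ∀ a : Bool,
    ∀ B : Set ℝ, MeasurableSet B →
      μ (r + 1) (h.extend p a) B * ∫⁻ v, b.respond r v h p a ∂(μ r h)
        = ∫⁻ v in B, b.respond r v h p a ∂(μ r h)
  /-- The seller best-responds at the beginning of a round, after every history. -/
  seller_opt : ∀ r m, r + m = n → ∀ h : Hist r, h.Feasible → ∀ s' : SellerStrategy,
    sellerUtility s' b (μ r h) m r h ≤ sellerUtility s b (μ r h) m r h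
  /-- The seller's continuation is a best response after every posted price. -/
  seller_opt_at : ∀ r m, r + (m + 1) = n → ∀ h : Hist r, h.Feasible → ∀ p ∈ h.allowed,
    ∀ s' : SellerStrategy,
      sellerUtilityAt s' b (μ r h) m r h p ≤ sellerUtilityAt s b (μ r h) m r h p
  /-- Every type of the buyer best-responds from the beginning of a round, after every
  history. -/
  buyer_opt : ∀ r m, r + m = n → ∀ h : Hist r, h.Feasible → ∀ v ∈ valueSpace,
    ∀ b' : BuyerStrategy, buyerUtility s b' v m r h ≤ buyerUtility s b v m r h
  /-- Every type of the buyer best-responds after every posted price. -/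
  buyer_opt_at : ∀ r m, r + (m + 1) = n → ∀ h : Hist r, h.Feasible → ∀ p ∈ h.allowed,
    ∀ v ∈ valueSpace, ∀ b' : BuyerStrategy,
      buyerUtilityAt s b' v m r h p ≤ buyerUtilityAt s b v m r h p

open Classical in
/-- In an `n` rounds game, `b` is a threshold strategy: there is a deterministic nonnegative
threshold, depending on the history including the current price, and a buyer of value `v`
accepts exactly when `v` is at least the threshold. -/
def BuyerStrategy.IsThreshold (b : BuyerStrategy) (n : ℕ) : Prop :=
  ∃ t : ∀ r : ℕ, Hist r → ℝ → ℝ,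
    ∀ r < n, ∀ h : Hist r, h.Feasible → ∀ p ∈ h.allowed,
      0 ≤ t r h p ∧
        ∀ v ∈ valueSpace, b.accept r v h p = if t r h p ≤ v then 1 else 0

end RepeatedSales

end

namespace RepeatedSales

noncomputable section

/-! A power law restricted to `[0, a)` is a rescaled copy of itself. So while nothing has been sold
and the seller believes `v < a`, play depends on the history only through `a`: with `m` rounds left
he asks `priceRate k m * a` and expects `revenueRate k m * a`. A sale at `p ≤ 1` settles the price.
All types he still considers possible are at least `p`, and he cannot raise the price, so he asks
`p` in every later round.

Suppose `j` rounds follow. Accepting `p` gives the type `t` the utility `(j + 1) * (t - p)`;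
rejecting makes `t` the top of the belief `[0, t)`, with utility `j * (t - priceRate k j * t)`.
Indifference is linear in `t`, so posting a price amounts to choosing the rejecting fraction `s = t
/ a`. The revenue is then `a` times `revenuePoly` at `s`, and a maximizer on the compact interval
`[0, 1]` defines the next rates.

The threshold is optimal for every type because the value of waiting grows in `v` at rate at most
`j`, that of accepting at a profit at rate `j + 1` (`waitingValue_le_add`,
`waitingValue_threshold`). Beliefs satisfy Bayes' rule by `Valid.belief_step`. Backward induction
bounds all deviations and shows that equilibrium play attains the bounds: `sellerUtility_le` and
`sellerUtility_seller`, `expTotal_le` and `expTotal_buyer`. -/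

/-! ### Recursion for the equilibrium price and revenue -/

/-- Revenue, per unit of the highest possible value, from a price rejected by the fraction `s` of
the range of values, when `j` further rounds follow the current one. -/
def revenuePoly (k j : ℕ) (q R s : ℝ) : ℝ :=
  (1 + j * q) * s * (1 - s ^ (k + 1)) + R * s ^ (k + 2)

theorem exists_revenuePoly_max (k j : ℕ) (q R : ℝ) :
    ∃ s ∈ Set.Icc (0 : ℝ) 1, ∀ x ∈ Set.Icc (0 : ℝ) 1,
      revenuePoly k j q R x ≤ revenuePoly k j q R s := by
  obtain ⟨s, hs, hmax⟩ := (isCompact_Icc (a := (0 : ℝ)) (b := 1)).exists_isMaxOn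
    (Set.nonempty_Icc.2 zero_le_one) (f := revenuePoly k j q R)
    (by unfold revenuePoly; fun_prop)
  exact ⟨s, hs, fun x hx => hmax hx⟩

/-- A fraction which maximizes the revenue. -/
def bestFraction (k j : ℕ) (q R : ℝ) : ℝ :=
  (exists_revenuePoly_max k j q R).choose

theorem bestFraction_mem (k j : ℕ) (q R : ℝ) : bestFraction k j q R ∈ Set.Icc (0 : ℝ) 1 :=
  (exists_revenuePoly_max k j q R).choose_spec.1

theorem revenuePoly_le_bestFraction (k j : ℕ) (q R : ℝ) {x : ℝ} (hx : x ∈ Set.Icc (0 : ℝ) 1) :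
    revenuePoly k j q R x ≤ revenuePoly k j q R (bestFraction k j q R) :=
  (exists_revenuePoly_max k j q R).choose_spec.2 x hx

/-- Equilibrium price and revenue before the first sale, per unit of the highest possible value,
as functions of the number of remaining rounds. -/
def rates (k : ℕ) : ℕ → ℝ × ℝ
  | 0 => (0, 0)
  | j + 1 =>
    -- This price makes the type at the fraction `bestFraction` of the range indifferent.
    ((1 + j * (rates k j).1) / (j + 1) * bestFraction k j (rates k j).1 (rates k j).2,
      revenuePoly k j (rates k j).1 (rates k j).2 (bestFraction k j (rates k j).1 (rates k j).2))

/-- The equilibrium price per unit of the highest possible value. -/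
def priceRate (k j : ℕ) : ℝ := (rates k j).1

/-- The equilibrium revenue per unit of the highest possible value. -/
def revenueRate (k j : ℕ) : ℝ := (rates k j).2

/-- The fraction of the range of values which rejects the equilibrium price when `j` further
rounds follow the current one. -/
def thresholdRate (k j : ℕ) : ℝ := bestFraction k j (priceRate k j) (revenueRate k j)

theorem thresholdRate_mem (k j : ℕ) : thresholdRate k j ∈ Set.Icc (0 : ℝ) 1 :=
  bestFraction_mem ..

theorem priceRate_succ (k j : ℕ) :
    priceRate k (j + 1) = (1 + j * priceRate k j) / (j + 1) * thresholdRate k j := rfl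

theorem revenueRate_succ (k j : ℕ) :
    revenueRate k (j + 1)
      = revenuePoly k j (priceRate k j) (revenueRate k j) (thresholdRate k j) := rfl

theorem priceRate_mem (k j : ℕ) : priceRate k j ∈ Set.Icc (0 : ℝ) 1 := by
  induction j with
  | zero => simp [priceRate, rates]
  | succ j ih =>
    obtain ⟨h0, h1⟩ := ih
    obtain ⟨t0, t1⟩ := thresholdRate_mem k j
    rw [priceRate_succ]
    refine ⟨by positivity, mul_le_one₀ ?_ t0 t1⟩
    rw [div_le_one (by positivity)]
    nlinarith [(Nat.cast_nonneg j : (0 : ℝ) ≤ j)]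

theorem one_add_mul_priceRate_pos (k j : ℕ) : 0 < 1 + j * priceRate k j := by
  have := (priceRate_mem k j).1
  positivity

theorem succ_mul_priceRate_succ (k j : ℕ) :
    (j + 1) * priceRate k (j + 1) = (1 + j * priceRate k j) * thresholdRate k j := by
  rw [priceRate_succ]
  field_simp

theorem revenueRate_nonneg (k j : ℕ) : 0 ≤ revenueRate k j := by
  cases j with
  | zero => simp [revenueRate, rates]
  | succ j =>
    have := revenuePoly_le_bestFraction k j (priceRate k j) (revenueRate k j)
      (x := 0) (by simp)
    rw [revenueRate_succ]
    refine le_trans (by simp [revenuePoly]) this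

/-! ### Thresholds and the value of waiting -/

/-- The value which is indifferent about the price `p` before the first sale, if the highest
possible value is `a` and `j` further rounds follow. -/
def threshold (k j : ℕ) (a p : ℝ) : ℝ :=
  -- For a low price the indifferent type becomes the new top upon rejection. For a high price it
  -- lies above `a`, and the next price stays `priceRate k j * a`.
  if (j + 1) * p ≤ (1 + j * priceRate k j) * a then (j + 1) * p / (1 + j * priceRate k j)
  else (j + 1) * p - j * priceRate k j * a

/-- Future prices never exceed the top (`priceRate ≤ 1`), so waiting has an option value.
Consequently every type that accepts can afford the price in all later rounds. -/
theorem le_threshold (k j : ℕ) {a p : ℝ} (ha : 0 ≤ a) (hp : 0 ≤ p) : p ≤ threshold k j a p := by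
  have hK := one_add_mul_priceRate_pos k j
  obtain ⟨h0, h1⟩ := priceRate_mem k j
  have hj : (0 : ℝ) ≤ j := Nat.cast_nonneg j
  unfold threshold
  split_ifs with h
  · rw [le_div_iff₀ hK]
    nlinarith [mul_nonneg (mul_nonneg hj hp) (sub_nonneg.2 h1)]
  · push Not at h
    have h2 : priceRate k j * a ≤ p := by
      have : priceRate k j * a ≤ a := mul_le_of_le_one_left ha h1
      by_contra! hc
      nlinarith [mul_le_mul_of_nonneg_left hc.le hj]
    nlinarith [mul_le_mul_of_nonneg_left h2 hj]

/-- The highest possible value after the rejection of `p`. A rejection which is impossible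
leaves it unchanged. -/
def nextTop (k j : ℕ) (a p : ℝ) : ℝ :=
  -- A threshold `0` makes rejection impossible; one of at least `a` makes it certain, hence
  -- uninformative.
  if 0 < threshold k j a p ∧ threshold k j a p < a then threshold k j a p else a

theorem nextTop_pos (k j : ℕ) {a : ℝ} (p : ℝ) (ha : 0 < a) : 0 < nextTop k j a p := by
  unfold nextTop
  split_ifs with h
  · exact h.1
  · exact ha

theorem nextTop_le (k j : ℕ) (a p : ℝ) : nextTop k j a p ≤ a := by
  unfold nextTop
  split_ifs with h
  · exact h.2.le
  · exact le_rfl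

/-- The two branches of `threshold` meet at the value `a`, so the position of the threshold relative
to `a` determines which indifference equation holds. -/
theorem threshold_of_lt {k j : ℕ} {a p : ℝ} (h : threshold k j a p < a) :
    (1 + j * priceRate k j) * threshold k j a p = (j + 1) * p := by
  have hK := one_add_mul_priceRate_pos k j
  unfold threshold at h ⊢
  split_ifs at h ⊢ with h1
  · field_simp
  · nlinarith

theorem threshold_of_ge {k j : ℕ} {a p : ℝ} (h : a ≤ threshold k j a p) :
    threshold k j a p = (j + 1) * p - j * priceRate k j * a := by
  have hK := one_add_mul_priceRate_pos k j
  unfold threshold at h ⊢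
  split_ifs at h ⊢ with h1
  · rw [le_div_iff₀ hK] at h
    have : (j + 1) * p = (1 + j * priceRate k j) * a := by linarith
    rw [this]
    field_simp
    ring
  · rfl

theorem threshold_priceRate (k j : ℕ) {a : ℝ} (ha : 0 ≤ a) :
    threshold k j a (priceRate k (j + 1) * a) = thresholdRate k j * a := by
  have hK := one_add_mul_priceRate_pos k j
  have h := succ_mul_priceRate_succ k j
  have ht := (thresholdRate_mem k j).2
  unfold threshold
  rw [← mul_assoc, h, if_pos]
  · field_simp
  · rw [mul_assoc]
    exact mul_le_mul_of_nonneg_left (mul_le_of_le_one_left ha ht) hK.le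

/-- Equilibrium utility of a buyer of value `v` from `m` rounds without an earlier sale when the
highest possible value is `a`. -/
def waitingValue (k : ℕ) : ℕ → ℝ → ℝ → ℝ
  | 0, _, _ => 0
  | j + 1, a, v =>
    -- After a sale the same price recurs in the `j` later rounds and may be declined there.
    max (v - priceRate k (j + 1) * a + j * max (v - priceRate k (j + 1) * a) 0)
      (waitingValue k j (nextTop k j a (priceRate k (j + 1) * a)) v)

theorem waitingValue_nonneg (k m : ℕ) (a v : ℝ) : 0 ≤ waitingValue k m a v := by
  induction m generalizing a with
  | zero => simp [waitingValue]
  | succ j ih => exact le_max_of_le_right (ih _)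

/-- At most `m` purchases can be made, so the slope in the value is at most `m`. This gives the
single crossing behind threshold behaviour. -/
theorem waitingValue_le_add (k m : ℕ) (a : ℝ) {v w : ℝ} (h : v ≤ w) :
    waitingValue k m a w ≤ waitingValue k m a v + m * (w - v) := by
  induction m generalizing a with
  | zero => simp [waitingValue]
  | succ j ih =>
    have hj : (0 : ℝ) ≤ j := Nat.cast_nonneg j
    simp only [waitingValue]
    push_cast
    set q := priceRate k (j + 1) * a
    refine max_le ?_ ?_
    · refine le_trans ?_ (add_le_add_left (le_max_left _ _) _)
      have : max (w - q) 0 ≤ max (v - q) 0 + (w - v) :=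
        max_le (by linarith [le_max_left (v - q) 0]) (by linarith [le_max_right (v - q) 0])
      nlinarith [mul_le_mul_of_nonneg_left this hj]
    · refine le_trans ?_ (add_le_add_left (le_max_right _ _) _)
      have := ih (nextTop k j a q)
      nlinarith

theorem waitingValue_zero (k m : ℕ) {a : ℝ} (ha : 0 < a) : waitingValue k m a 0 = 0 := by
  refine le_antisymm ?_ (waitingValue_nonneg ..)
  induction m generalizing a with
  | zero => simp [waitingValue]
  | succ j ih =>
    have := mul_nonneg (priceRate_mem k (j + 1)).1 ha.le
    refine max_le ?_ (ih (nextTop_pos _ _ _ ha))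
    rw [max_eq_right (by linarith)]
    linarith

/-- The threshold value is indifferent, given the value of waiting for the top type. -/
theorem waitingValue_threshold_aux {k j : ℕ}
    (hj : ∀ a v : ℝ, 0 < a → a ≤ v → waitingValue k j a v = j * (v - priceRate k j * a))
    {a p : ℝ} (ha : 0 < a) (hp : 0 ≤ p) :
    waitingValue k j (nextTop k j a p) (threshold k j a p)
      = (j + 1) * (threshold k j a p - p) := by
  have hle := le_threshold k j ha.le hp
  rcases lt_or_ge (threshold k j a p) a with h | h
  -- At threshold `0` the top is not moved, so the formula for the top type does not apply; both
  -- sides vanish instead.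
  · rcases (hp.trans hle).eq_or_lt with h0 | h0
    · rw [← h0, waitingValue_zero _ _ (nextTop_pos _ _ _ ha), show p = 0 by linarith]
      simp
    · rw [nextTop, if_pos ⟨h0, h⟩, hj _ _ h0 le_rfl]
      linarith [threshold_of_lt h]
  · rw [nextTop, if_neg (by simp [h]), hj _ _ ha h]
    have := threshold_of_ge h
    generalize threshold k j a p = t at *
    subst this
    ring

theorem waitingValue_le_accept_aux {k j : ℕ}
    (hj : ∀ a v : ℝ, 0 < a → a ≤ v → waitingValue k j a v = j * (v - priceRate k j * a))
    {a p v : ℝ} (ha : 0 < a) (hp : 0 ≤ p) (hv : threshold k j a p ≤ v) :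
    waitingValue k j (nextTop k j a p) v ≤ (j + 1) * (v - p) := by
  have h1 := waitingValue_threshold_aux hj ha hp
  have h2 := waitingValue_le_add k j (nextTop k j a p) hv
  linarith

/-- Since `thresholdRate ≤ 1`, a type at or above the top accepts at once. The induction hypothesis
is what the auxiliary lemmas need to compare this with waiting. -/
theorem waitingValue_top (k m : ℕ) {a v : ℝ} (ha : 0 < a) (hv : a ≤ v) :
    waitingValue k m a v = m * (v - priceRate k m * a) := by
  induction m generalizing a v with
  | zero => simp [waitingValue]
  | succ j ih =>
    obtain ⟨h0, h1⟩ := priceRate_mem k (j + 1)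
    have hq : priceRate k (j + 1) * a ≤ v := (mul_le_of_le_one_left ha.le h1).trans hv
    have ht : threshold k j a (priceRate k (j + 1) * a) ≤ v := by
      rw [threshold_priceRate _ _ ha.le]
      exact (mul_le_of_le_one_left ha.le (thresholdRate_mem k j).2).trans hv
    have := waitingValue_le_accept_aux (fun a v => ih) ha (mul_nonneg h0 ha.le) ht
    rw [waitingValue, max_eq_left (sub_nonneg.2 hq), max_eq_left]
    · push_cast; ring
    · linarith

theorem waitingValue_threshold (k j : ℕ) {a p : ℝ} (ha : 0 < a) (hp : 0 ≤ p) :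
    waitingValue k j (nextTop k j a p) (threshold k j a p)
      = (j + 1) * (threshold k j a p - p) :=
  waitingValue_threshold_aux (fun _ _ => waitingValue_top k j) ha hp

theorem waitingValue_le_accept (k j : ℕ) {a p v : ℝ} (ha : 0 < a) (hp : 0 ≤ p)
    (hv : threshold k j a p ≤ v) :
    waitingValue k j (nextTop k j a p) v ≤ (j + 1) * (v - p) :=
  waitingValue_le_accept_aux (fun _ _ => waitingValue_top k j) ha hp hv

/-- For `p ≤ v`, going down from the indifferent type costs acceptance more than waiting. For `v <
p`, acceptance is a loss that later rounds at `min 1 p` cannot recover. -/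
theorem accept_le_waitingValue (k j : ℕ) {a p v : ℝ} (ha : 0 < a) (hp : 0 ≤ p)
    (hv : v ≤ threshold k j a p) (hv1 : v ≤ 1) :
    v - p + j * max (v - min 1 p) 0 ≤ waitingValue k j (nextTop k j a p) v := by
  rcases le_or_gt p v with h | h
  · have h1 := waitingValue_threshold k j ha hp
    have h2 := waitingValue_le_add k j (nextTop k j a p) hv
    rw [min_eq_right (h.trans hv1), max_eq_left (by linarith)]
    linarith
  · have h1 := waitingValue_nonneg k j (nextTop k j a p) v
    rw [max_eq_right]
    · linarith
    · exact sub_nonpos.2 (le_min hv1 h.le)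

/-! ### States: what the equilibrium remembers of a history -/

/-- The data of a history on which the equilibrium depends. -/
abbrev State : Type := Bool × ℝ × ℝ × ℝ

namespace State

/-- Has a price been accepted? -/
abbrev sold (x : State) : Bool := x.1

/-- The lowest value the seller believes possible. -/
abbrev bot (x : State) : ℝ := x.2.1

/-- The highest value the seller believes possible. -/
abbrev top (x : State) : ℝ := x.2.2.1

/-- The minimum of `1` and the accepted prices. -/
abbrev cap (x : State) : ℝ := x.2.2.2

/-- The buyer's threshold for the price `p` when `j` further rounds follow the current one. -/
def thr (k j : ℕ) (x : State) (p : ℝ) : ℝ :=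
  if x.sold = true then p else threshold k j x.top p

/-- The seller's price when `m` rounds remain. -/
def price (k m : ℕ) (x : State) : ℝ :=
  if x.sold = true then x.cap else priceRate k m * x.top

/-- The state after the response `c.2` to the price `c.1`, if `j` rounds follow the current one. -/
def step (k j : ℕ) (x : State) (c : ℝ × Bool) : State :=
  -- After a sale beliefs are frozen; only the cap can fall.
  if x.sold = true then (true, x.bot, x.top, if c.2 = true then min x.cap c.1 else x.cap)
  else if c.2 = true then (true, threshold k j x.top c.1, x.top, min x.cap c.1)
  else (false, x.bot, nextTop k j x.top c.1, x.cap)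

/-- The seller's belief. -/
def belief (k : ℕ) (x : State) : Measure ℝ :=
  -- An empty interval records an acceptance of probability zero. The point mass at `1` then makes
  -- the buyer certain to accept any cap.
  if x.bot < x.top then (powerLaw k)[|Set.Ico x.bot x.top] else Measure.dirac 1

/-- The seller's equilibrium revenue from `m` rounds. -/
def revenue (k m : ℕ) (x : State) : ℝ :=
  if x.sold = true then m * x.cap else revenueRate k m * x.top

/-- The equilibrium utility of a buyer of value `v` from `m` rounds. -/
def utility (k m : ℕ) (x : State) (v : ℝ) : ℝ :=
  if x.sold = true then m * max (v - x.cap) 0 else waitingValue k m x.top v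

/-- The properties shared by the states of all histories. -/
structure Valid (x : State) : Prop where
  bot_nonneg : 0 ≤ x.bot
  top_pos : 0 < x.top
  top_le_one : x.top ≤ 1
  cap_nonneg : 0 ≤ x.cap
  cap_le_one : x.cap ≤ 1
  cap_le_bot : x.sold = true → x.bot < x.top → x.cap ≤ x.bot
  of_not_sold : x.sold = false → x.bot = 0 ∧ x.cap = 1

/-! ### Measurability of the state dynamics -/

theorem measurable_threshold (k j : ℕ) :
    Measurable fun x : ℝ × ℝ => threshold k j x.1 x.2 := by
  unfold threshold
  refine Measurable.ite (measurableSet_le ?_ ?_) ?_ ?_ <;> fun_prop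

theorem measurable_nextTop (k j : ℕ) : Measurable fun x : ℝ × ℝ => nextTop k j x.1 x.2 := by
  have := measurable_threshold k j
  unfold nextTop
  refine Measurable.ite ?_ this measurable_fst
  exact (measurableSet_lt measurable_const this).inter (measurableSet_lt this measurable_fst)

theorem measurableSet_sold : MeasurableSet {x : State | x.sold = true} :=
  measurable_fst (measurableSet_singleton true)

theorem measurable_thr (k j : ℕ) : Measurable fun x : State × ℝ => x.1.thr k j x.2 := by
  unfold thr
  refine Measurable.ite (measurable_fst measurableSet_sold) measurable_snd ?_
  exact (measurable_threshold k j).comp (by fun_prop : Measurable fun x : State × ℝ =>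
    (x.1.top, x.2))

theorem measurable_price (k m : ℕ) : Measurable (price k m) := by
  unfold price
  refine Measurable.ite measurableSet_sold ?_ ?_ <;> fun_prop

theorem measurable_step (k j : ℕ) :
    Measurable fun x : State × (ℝ × Bool) => x.1.step k j x.2 := by
  have hb : MeasurableSet {x : State × (ℝ × Bool) | x.2.2 = true} :=
    (by fun_prop : Measurable fun x : State × (ℝ × Bool) => x.2.2) (measurableSet_singleton true)
  have hp : Measurable fun x : State × (ℝ × Bool) => (x.1.top, x.2.1) := by fun_prop
  unfold step
  refine Measurable.ite (measurable_fst measurableSet_sold) ?_ (Measurable.ite hb ?_ ?_)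
  · have : Measurable fun x : State × (ℝ × Bool) =>
        if x.2.2 = true then min x.1.cap x.2.1 else x.1.cap :=
      Measurable.ite hb (by fun_prop) (by fun_prop)
    fun_prop
  · have := (measurable_threshold k j).comp hp
    simp only [Function.comp_def] at this
    fun_prop
  · have := (measurable_nextTop k j).comp hp
    simp only [Function.comp_def] at this
    fun_prop

/-! ### Invariants and the buyer's one-round comparison -/

theorem Valid.step {x : State} (hx : x.Valid) (k j : ℕ) {p : ℝ} (hp : 0 ≤ p) (a : Bool) :
    (x.step k j (p, a)).Valid := by
  obtain ⟨s, l, u, c⟩ := x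
  obtain ⟨h1, h2, h3, h4, h5, h6, h7⟩ := hx
  have ht := le_threshold k j (a := u) h2.le hp
  have hn := nextTop_pos k j (a := u) p h2
  have hn' := nextTop_le k j u p
  simp only [State.sold, State.bot, State.top, State.cap] at *
  cases s <;> cases a <;> simp only [State.step] <;> constructor <;>
    simp_all [State.sold, State.bot, State.top, State.cap]
  · linarith
  · linarith

theorem Valid.le_thr {x : State} (hx : x.Valid) (k j : ℕ) {p : ℝ} (hp : 0 ≤ p) :
    p ≤ x.thr k j p := by
  unfold thr
  split_ifs
  · exact le_rfl
  · exact le_threshold k j hx.top_pos.le hp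

theorem Valid.price_nonneg {x : State} (hx : x.Valid) (k m : ℕ) : 0 ≤ x.price k m := by
  unfold State.price
  split_ifs
  · exact hx.cap_nonneg
  · exact mul_nonneg (priceRate_mem k m).1 hx.top_pos.le

theorem Valid.price_le_cap {x : State} (hx : x.Valid) (k m : ℕ) : x.price k m ≤ x.cap := by
  unfold State.price
  split_ifs with h
  · exact le_rfl
  · rw [(hx.of_not_sold (by simpa using h)).2]
    exact mul_le_one₀ (priceRate_mem k m).2 hx.top_pos.le hx.top_le_one

theorem utility_nonneg (x : State) (k m : ℕ) (v : ℝ) : 0 ≤ x.utility k m v := by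
  unfold State.utility
  split_ifs
  · positivity
  · exact waitingValue_nonneg ..

theorem Valid.revenue_nonneg {x : State} (hx : x.Valid) (k m : ℕ) : 0 ≤ x.revenue k m := by
  unfold State.revenue
  split_ifs
  · exact mul_nonneg (Nat.cast_nonneg m) hx.cap_nonneg
  · exact mul_nonneg (revenueRate_nonneg k m) hx.top_pos.le

/-- Values above the threshold prefer to accept. -/
theorem Valid.utility_reject_le {x : State} (hx : x.Valid) (k j : ℕ) {p v : ℝ} (hp : 0 ≤ p)
    (hc : min 1 p ≤ x.cap) (hv : x.thr k j p ≤ v) (hv1 : v ≤ 1) :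
    (x.step k j (p, false)).utility k j v ≤ v - p + (x.step k j (p, true)).utility k j v := by
  have hpv := (hx.le_thr k j hp).trans hv
  rw [min_eq_right (hpv.trans hv1)] at hc
  unfold State.thr at hv
  cases h : x.sold
  · simp only [State.step, State.utility, h, if_true, if_false, Bool.false_eq_true] at hv ⊢
    have := waitingValue_le_accept k j hx.top_pos hp hv
    rw [min_eq_right hc]
    change waitingValue k j (nextTop k j x.top p) v ≤ v - p + j * max (v - p) 0
    rw [max_eq_left (by linarith)]
    linarith
  · simp only [State.step, State.utility, h, if_true, if_false, Bool.false_eq_true]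
    rw [min_eq_right hc, max_eq_left (a := v - p) (by linarith)]
    have : max (v - x.cap) 0 ≤ v - p := max_le (by linarith) (by linarith)
    have := mul_le_mul_of_nonneg_left this (Nat.cast_nonneg (α := ℝ) j)
    linarith

/-- Values below the threshold prefer to reject. -/
theorem Valid.utility_accept_le {x : State} (hx : x.Valid) (k j : ℕ) {p v : ℝ} (hp : 0 ≤ p)
    (hv : v < x.thr k j p) (hv1 : v ≤ 1) :
    v - p + (x.step k j (p, true)).utility k j v ≤ (x.step k j (p, false)).utility k j v := by
  unfold State.thr at hv
  cases h : x.sold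
  · simp only [State.step, State.utility, h, if_true, if_false, Bool.false_eq_true] at hv ⊢
    rw [(hx.of_not_sold h).2]
    exact accept_le_waitingValue k j hx.top_pos hp hv.le hv1
  · simp only [State.step, State.utility, h, if_true, if_false, Bool.false_eq_true] at hv ⊢
    have : max (v - min x.cap p) 0 ≤ max (v - x.cap) 0 := by
      refine max_le ?_ (le_max_right _ _)
      rcases le_total x.cap p with h' | h'
      · rw [min_eq_left h']
        exact le_max_left _ _
      · rw [min_eq_right h']
        exact le_max_of_le_right (by linarith)
    have := mul_le_mul_of_nonneg_left this (Nat.cast_nonneg (α := ℝ) j)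
    linarith

/-- At the equilibrium price the better response yields the equilibrium utility. -/
theorem Valid.utility_succ {x : State} (hx : x.Valid) (k j : ℕ) {v : ℝ} :
    x.utility k (j + 1) v
      = max (v - x.price k (j + 1) + (x.step k j (x.price k (j + 1), true)).utility k j v)
        ((x.step k j (x.price k (j + 1), false)).utility k j v) := by
  have hle := hx.price_le_cap k (j + 1)
  cases h : x.sold
  · simp only [State.step, State.utility, State.price, h, if_true, if_false,
      Bool.false_eq_true] at hle ⊢
    rw [min_eq_right hle]
    rfl
  · simp only [State.step, State.utility, State.price, h, if_true, if_false,
      Bool.false_eq_true, min_self]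
    push_cast
    have hj := mul_nonneg (Nat.cast_nonneg (α := ℝ) j) (le_max_right (v - x.cap) 0)
    rcases le_total (v - x.cap) 0 with h' | h'
    · rw [max_eq_right h', max_eq_right] <;> linarith
    · rw [max_eq_left h', max_eq_left] <;> linarith

end State

/-! ### Strategies as functions of the state -/

open State

/-- The state reached by a history of the game with `n` rounds. -/
def state (k n : ℕ) : ∀ r : ℕ, Hist r → State
  | 0, _ => (false, 0, 1, 1)
  | r + 1, h => (state k n r (Fin.init h)).step k (n - (r + 1)) (h (Fin.last r))

theorem state_extend (k n r : ℕ) (h : Hist r) (p : ℝ) (a : Bool) :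
    state k n (r + 1) (h.extend p a) = (state k n r h).step k (n - (r + 1)) (p, a) := by
  simp [state, Hist.extend]

theorem measurable_state (k n r : ℕ) : Measurable (state k n r) := by
  induction r with
  | zero => exact measurable_const
  | succ r ih =>
    have h1 : Measurable fun h : Hist (r + 1) => state k n r (Fin.init h) :=
      ih.comp (measurable_pi_lambda _ fun i => measurable_pi_apply _)
    exact (measurable_step k (n - (r + 1))).comp (h1.prodMk (measurable_pi_apply (Fin.last r)))

theorem Hist.Feasible.init {r : ℕ} {h : Hist (r + 1)} (hf : h.Feasible) :
    Hist.Feasible (r := r) (Fin.init h) :=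
  fun i => ⟨(hf i.castSucc).1, fun j hj => (hf i.castSucc).2 j.castSucc (by simpa using hj)⟩

theorem Hist.Feasible.extend {r : ℕ} {h : Hist r} (hf : h.Feasible) {p : ℝ} (hp : p ∈ h.allowed)
    (a : Bool) : (h.extend p a).Feasible := by
  intro i
  induction i using Fin.lastCases with
  | last =>
    refine ⟨by simpa [Hist.extend] using hp.1, fun j hj => ?_⟩
    induction j using Fin.lastCases with
    | last => exact absurd hj (lt_irrefl _)
    | cast j => simpa [Hist.extend] using hp.2 j
  | cast i =>
    refine ⟨by simpa [Hist.extend] using (hf i).1, fun j hj => ?_⟩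
    induction j using Fin.lastCases with
    | last => exact absurd hj (not_lt.2 (Fin.le_last _))
    | cast j => simpa [Hist.extend] using (hf i).2 j (by simpa using hj)

theorem valid_state (k n : ℕ) {r : ℕ} {h : Hist r} (hf : h.Feasible) : (state k n r h).Valid := by
  induction r with
  | zero => constructor <;> simp [state, State.top, State.cap]
  | succ r ih => exact (ih hf.init).step _ _ (hf _).1 _

theorem cap_step_le (k j : ℕ) (x : State) (c : ℝ × Bool) :
    (x.step k j c).cap = if c.2 = true then min x.cap c.1 else x.cap := by
  unfold State.step
  split_ifs <;> rfl

theorem cap_le_of_accepted (k n : ℕ) {r : ℕ} (h : Hist r) (i : Fin r) (hi : (h i).2 = true) :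
    (state k n r h).cap ≤ (h i).1 := by
  induction r with
  | zero => exact i.elim0
  | succ r ih =>
    rw [state, cap_step_le]
    induction i using Fin.lastCases with
    | last =>
      rw [if_pos hi]
      exact min_le_right _ _
    | cast i =>
      have := ih (Fin.init h) i hi
      split_ifs
      · exact (min_le_left _ _).trans this
      · exact this

/-- The cap records the commitment up to truncation at `1`. Thus an allowed price above the cap
exceeds `1`, and no type should accept it. -/
theorem min_one_le_cap (k n : ℕ) {r : ℕ} (h : Hist r) {p : ℝ} (hp : p ∈ h.allowed) :
    min 1 p ≤ (state k n r h).cap := by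
  induction r with
  | zero => exact min_le_left _ _
  | succ r ih =>
    have := ih (Fin.init h) ⟨hp.1, fun i hi => hp.2 i.castSucc hi⟩
    rw [state, cap_step_le]
    split_ifs with h'
    · exact le_min this ((min_le_right _ _).trans (hp.2 _ h'))
    · exact this

theorem price_mem_allowed (k n m : ℕ) {r : ℕ} {h : Hist r} (hf : h.Feasible) :
    (state k n r h).price k m ∈ h.allowed :=
  ⟨(valid_state k n hf).price_nonneg k m, fun i hi =>
    ((valid_state k n hf).price_le_cap k m).trans (cap_le_of_accepted k n h i hi)⟩

/-- The seller's equilibrium strategy. -/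
def seller (k n : ℕ) : SellerStrategy where
  price r := Kernel.deterministic (fun h => (state k n r h).price k (n - r))
    ((measurable_price k (n - r)).comp (measurable_state k n r))
  isMarkov r := inferInstance
  allowed r h hf := by
    rw [Kernel.deterministic_apply, ae_dirac_eq]
    exact price_mem_allowed k n _ hf

/-- The buyer's equilibrium strategy. -/
def buyer (k n : ℕ) : BuyerStrategy where
  -- The buyer counts the rounds after the current one, `n - (r + 1)`; the seller's `n - r` includes
  -- it.
  accept r v h p := if (state k n r h).thr k (n - (r + 1)) p ≤ v then 1 else 0
  accept_le_one r v h p := by split_ifs <;> simp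
  measurable_accept r := by
    refine Measurable.ite (measurableSet_le ?_ measurable_fst) measurable_const measurable_const
    exact (measurable_thr k (n - (r + 1))).comp
      (((measurable_state k n r).comp (by fun_prop)).prodMk (by fun_prop))

theorem isThreshold_buyer (k n : ℕ) : (buyer k n).IsThreshold n :=
  ⟨fun r h p => (state k n r h).thr k (n - (r + 1)) p, fun _ _ _ hf _ hp =>
    ⟨hp.1.trans ((valid_state k n hf).le_thr _ _ hp.1), fun _ _ => by
      simp only [buyer]⟩⟩

/-! ### The prior, the beliefs and Bayes' rule -/

theorem powerLaw_Ico (k : ℕ) {a b : ℝ} (ha : 0 ≤ a) (hab : a ≤ b) (hb : b ≤ 1) :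
    powerLaw k (Set.Ico a b) = ENNReal.ofReal (b ^ (k + 1) - a ^ (k + 1)) := by
  have hsub : Set.Ico a b ⊆ Set.Icc 0 1 := fun x hx => ⟨ha.trans hx.1, hx.2.le.trans hb⟩
  have hcont : Continuous fun x : ℝ => ((k : ℝ) + 1) * x ^ k := by fun_prop
  rw [powerLaw, withDensity_apply _ measurableSet_Ico, Measure.restrict_restrict measurableSet_Ico,
    Set.inter_eq_left.2 hsub, Measure.restrict_congr_set Ico_ae_eq_Ioc,
    ← ofReal_integral_eq_lintegral_ofReal, ← intervalIntegral.integral_of_le hab,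
    intervalIntegral.integral_const_mul, integral_pow]
  · congr 1
    field_simp
  · exact (hcont.intervalIntegrable a b).1
  · filter_upwards [ae_restrict_mem measurableSet_Ioc] with x hx
    have := ha.trans hx.1.le
    positivity

theorem powerLaw_ae_mem_valueSpace (k : ℕ) : ∀ᵐ v ∂(powerLaw k), v ∈ valueSpace :=
  (withDensity_absolutelyContinuous _ _).ae_le (ae_restrict_mem measurableSet_Icc)

theorem powerLaw_ae_mem_Ico (k : ℕ) : ∀ᵐ v ∂(powerLaw k), v ∈ Set.Ico (0 : ℝ) 1 := by
  have h1 : ∀ᵐ v ∂(powerLaw k), v ≠ 1 :=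
    ((withDensity_absolutelyContinuous _ _).trans
      Measure.restrict_le_self.absolutelyContinuous).ae_le (Measure.ae_ne volume 1)
  filter_upwards [powerLaw_ae_mem_valueSpace k, h1] with v hv hv1
  exact ⟨hv.1, lt_of_le_of_ne hv.2 hv1⟩

instance (k : ℕ) : IsProbabilityMeasure (powerLaw k) :=
  ⟨by
    rw [measure_congr (Filter.eventuallyEq_univ.2 (powerLaw_ae_mem_Ico k)).symm]
    change powerLaw k (Set.Ico 0 1) = 1
    rw [powerLaw_Ico k le_rfl zero_le_one le_rfl]
    simp⟩

/-- The values which give the response `a` if the threshold is `t`. -/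
def responseSet (t : ℝ) : Bool → Set ℝ
  | true => Set.Ici t
  | false => Set.Iio t

theorem measurableSet_responseSet (t : ℝ) (a : Bool) : MeasurableSet (responseSet t a) := by
  cases a
  · exact measurableSet_Iio
  · exact measurableSet_Ici

theorem responseSet_not (t : ℝ) (a : Bool) : responseSet t (!a) = (responseSet t a)ᶜ := by
  cases a <;> simp [responseSet]

theorem respond_buyer (k n r : ℕ) (h : Hist r) (p v : ℝ) (a : Bool) :
    (buyer k n).respond r v h p a
      = (responseSet ((state k n r h).thr k (n - (r + 1)) p) a).indicator 1 v := by
  cases a <;> by_cases hv : (state k n r h).thr k (n - (r + 1)) p ≤ v <;>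
    simp [BuyerStrategy.respond, buyer, responseSet, Set.indicator, hv]

theorem measure_mul_eq_of_null {α : Type*} [MeasurableSpace α] {μ : Measure α} {S : Set α}
    (hS : μ S = 0) (ν : Measure α) (B : Set α) : ν B * μ S = μ (S ∩ B) := by
  rw [hS, measure_mono_null Set.inter_subset_left hS, mul_zero]

theorem measure_eq_one_of_ae_mem {α : Type*} [MeasurableSpace α] {μ : Measure α}
    [IsProbabilityMeasure μ] {S : Set α} (hS : ∀ᵐ x ∂μ, x ∈ S) : μ S = 1 :=
  (measure_congr (Filter.eventuallyEq_univ.2 hS)).trans measure_univ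

theorem measure_mul_eq_of_ae {α : Type*} [MeasurableSpace α] {μ : Measure α}
    [IsProbabilityMeasure μ] {S : Set α} (hS : ∀ᵐ x ∂μ, x ∈ S) (B : Set α) :
    μ B * μ S = μ (S ∩ B) := by
  rw [measure_eq_one_of_ae_mem hS, mul_one]
  refine measure_congr ?_
  filter_upwards [hS] with x hx
  exact propext ⟨fun h => ⟨hx, h⟩, fun h => h.2⟩

namespace State

theorem Valid.powerLaw_ne_zero {x : State} (hx : x.Valid) (k : ℕ) (h : x.bot < x.top) :
    powerLaw k (Set.Ico x.bot x.top) ≠ 0 := by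
  rw [powerLaw_Ico k hx.bot_nonneg h.le hx.top_le_one, Ne, ENNReal.ofReal_eq_zero, not_le, sub_pos]
  exact pow_lt_pow_left₀ h hx.bot_nonneg (Nat.succ_ne_zero k)

theorem Valid.isProbabilityMeasure_belief {x : State} (hx : x.Valid) (k : ℕ) :
    IsProbabilityMeasure (x.belief k) := by
  unfold belief
  split_ifs with h
  · exact cond_isProbabilityMeasure (hx.powerLaw_ne_zero k h)
  · infer_instance

theorem belief_ae_mem_valueSpace (k : ℕ) (x : State) :
    ∀ᵐ v ∂(x.belief k), v ∈ valueSpace := by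
  unfold belief
  split_ifs with h
  · exact cond_absolutelyContinuous.ae_le (powerLaw_ae_mem_valueSpace k)
  · rw [ae_dirac_eq]
    exact ⟨zero_le_one, le_rfl⟩

theorem Valid.belief_ae_cap_le {x : State} (hx : x.Valid) (k : ℕ) (hs : x.sold = true) :
    ∀ᵐ v ∂(x.belief k), x.cap ≤ v := by
  unfold belief
  split_ifs with h
  · exact ae_cond_of_forall_mem measurableSet_Ico
      fun v hv => (hx.cap_le_bot hs h).trans hv.1
  · rw [ae_dirac_eq]
    exact hx.cap_le_one

theorem belief_initial (k : ℕ) : belief k (false, 0, 1, 1) = powerLaw k := by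
  rw [belief, if_pos (by exact zero_lt_one)]
  ext B hB
  rw [cond_apply measurableSet_Ico, powerLaw_Ico k le_rfl zero_le_one le_rfl]
  simp only [one_pow, ne_eq, Nat.add_eq_zero_iff, one_ne_zero, and_false, not_false_eq_true,
    zero_pow, sub_zero, ENNReal.ofReal_one, inv_one, one_mul]
  refine measure_congr ?_
  filter_upwards [powerLaw_ae_mem_Ico k] with x hx
  exact propext ⟨fun h => h.2, fun h => ⟨hx, h⟩⟩

/-- After a sale every value in the support of the belief gives the same response. -/
theorem Valid.belief_ae_response {x : State} (hx : x.Valid) (k j : ℕ) (hs : x.sold = true)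
    {p : ℝ} (hc : min 1 p ≤ x.cap) :
    ∀ᵐ v ∂(x.belief k), v ∈ responseSet (x.thr k j p) (decide (p ≤ x.cap)) := by
  simp only [thr, hs, if_true]
  filter_upwards [hx.belief_ae_cap_le k hs, belief_ae_mem_valueSpace k x] with v hv hv1
  by_cases h : p ≤ x.cap
  · simpa [h, responseSet] using h.trans hv
  · have : 1 < p := by
      by_contra! h1
      exact h (by rwa [min_eq_right h1] at hc)
    simpa [h, responseSet] using hv1.2.trans_lt this

/-- Scale invariance of the power law: the probability depends only on the ratio to the top. -/
theorem Valid.belief_Iio {x : State} (hx : x.Valid) (k : ℕ) (hs : x.sold = false) {t : ℝ}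
    (ht : 0 ≤ t) :
    x.belief k (Set.Iio t) = ENNReal.ofReal ((min t x.top / x.top) ^ (k + 1)) := by
  have h0 := (hx.of_not_sold hs).1
  have hu := hx.top_pos
  rw [belief, h0, if_pos hu, cond_apply measurableSet_Ico, Set.Ico_inter_Iio, min_comm,
    powerLaw_Ico k le_rfl hu.le hx.top_le_one, powerLaw_Ico k le_rfl (le_min ht hu.le)
      ((min_le_right _ _).trans hx.top_le_one), mul_comm, ← div_eq_mul_inv,
    ← ENNReal.ofReal_div_of_pos (by simpa using pow_pos hu (k + 1))]
  simp [div_pow]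

theorem Valid.belief_Ici {x : State} (hx : x.Valid) (k : ℕ) (hs : x.sold = false) {t : ℝ}
    (ht : 0 ≤ t) :
    x.belief k (Set.Ici t) = ENNReal.ofReal (1 - (min t x.top / x.top) ^ (k + 1)) := by
  have := hx.isProbabilityMeasure_belief k
  have := hx.top_pos
  rw [← Set.compl_Iio, prob_compl_eq_one_sub measurableSet_Iio, hx.belief_Iio k hs ht,
    ENNReal.ofReal_sub _ (by positivity), ENNReal.ofReal_one]

/-- Bayes' rule. -/
theorem Valid.belief_step {x : State} (hx : x.Valid) (k j : ℕ) {p : ℝ} (hp : 0 ≤ p)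
    (hc : min 1 p ≤ x.cap) (a : Bool) (B : Set ℝ) :
    (x.step k j (p, a)).belief k B * x.belief k (responseSet (x.thr k j p) a)
      = x.belief k (responseSet (x.thr k j p) a ∩ B) := by
  have hprob := hx.isProbabilityMeasure_belief k
  cases hs : x.sold
  · have h0 := (hx.of_not_sold hs).1
    have hu := hx.top_pos
    have ht := hp.trans (le_threshold k j hu.le hp)
    -- Conditioning the prior on `[0, top)` and then on the response is conditioning on the
    -- intersection.
    have hcond : ∀ S T : Set ℝ, MeasurableSet S → Set.Ico 0 x.top ∩ S = T →
        (powerLaw k)[|T] B * x.belief k S = x.belief k (S ∩ B) := by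
      intro S T hS hT
      rw [belief, h0, if_pos hu, ← hT, ← cond_cond_eq_cond_inter measurableSet_Ico hS,
        cond_mul_eq_inter hS]
    have hnull : ∀ t : ℝ, x.top ≤ t → x.belief k (Set.Ici t) = 0 := by
      intro t h
      rw [hx.belief_Ici k hs (hu.le.trans h), min_eq_right h, div_self hu.ne']
      simp
    simp only [State.step, thr, hs, Bool.false_eq_true, if_false]
    cases a
    · simp only [Bool.false_eq_true, if_false, responseSet]
      rcases ht.eq_or_lt with h | h
      · refine measure_mul_eq_of_null ?_ _ _
        rw [hx.belief_Iio k hs ht, ← h, min_eq_left hu.le]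
        simp
      · unfold nextTop
        by_cases h' : threshold k j x.top p < x.top
        · rw [if_pos ⟨h, h'⟩]
          rw [belief, if_pos (by exact h0.trans_lt h)]
          refine hcond _ _ measurableSet_Iio ?_
          rw [Set.Ico_inter_Iio, min_eq_right h'.le]
          exact congrArg (Set.Ico · _) h0.symm
        · rw [if_neg (by tauto)]
          refine measure_mul_eq_of_ae (μ := x.belief k) ?_ B
          filter_upwards [measure_eq_zero_iff_ae_notMem.1 (hnull _ (not_lt.1 h'))] with v hv
          simpa using hv
    · simp only [if_true, responseSet]
      by_cases h' : threshold k j x.top p < x.top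
      · rw [belief, if_pos (by exact h')]
        refine hcond _ _ measurableSet_Ici ?_
        ext v
        exact ⟨fun hv => ⟨hv.2, hv.1.2⟩, fun hv => ⟨⟨ht.trans hv.1, hv.2⟩, hv.1⟩⟩
      · exact measure_mul_eq_of_null (hnull _ (not_lt.1 h')) _ _
  · have hb : (x.step k j (p, a)).belief k = x.belief k := by
      simp only [State.step, hs, if_true]
      rfl
    rw [hb]
    have hae := hx.belief_ae_response k j hs hc
    -- After a sale a response is either certain or null, so the frozen belief satisfies Bayes'
    -- rule.
    by_cases ha : decide (p ≤ x.cap) = a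
    · exact measure_mul_eq_of_ae (ha ▸ hae) B
    · refine measure_mul_eq_of_null ?_ _ _
      rw [show decide (p ≤ x.cap) = !a by cases a <;> simpa using ha, responseSet_not] at hae
      simpa [ae_iff] using hae

/-! ### The seller's one-round problem -/

/-- The seller's expected revenue from posting `p`, when equilibrium play follows. -/
def priceRevenue (k j : ℕ) (x : State) (p : ℝ) : ℝ≥0∞ :=
  x.belief k (Set.Ici (x.thr k j p)) *
      (ENNReal.ofReal p + ENNReal.ofReal ((x.step k j (p, true)).revenue k j))
    + x.belief k (Set.Iio (x.thr k j p)) * ENNReal.ofReal ((x.step k j (p, false)).revenue k j)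

/-- By indifference `(j + 1) * p = (1 + j * priceRate k j) * s * top`, so the price enters only
through the rejecting fraction `s`. Prices that nobody accepts all correspond to `s = 1`. -/
theorem Valid.priceRevenue_of_not_sold {x : State} (hx : x.Valid) (k j : ℕ) (hs : x.sold = false)
    {p : ℝ} (hp : 0 ≤ p) :
    x.priceRevenue k j p = ENNReal.ofReal (x.top * revenuePoly k j (priceRate k j)
      (revenueRate k j) (min (threshold k j x.top p) x.top / x.top)) := by
  have hu := hx.top_pos
  have hle := le_threshold k j hu.le hp
  have ht := hp.trans hle
  have hrev : ∀ a, 0 ≤ (x.step k j (p, a)).revenue k j :=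
    fun a => (hx.step k j hp a).revenue_nonneg k j
  have hthr : x.thr k j p = threshold k j x.top p := by simp [thr, hs]
  set s := min (threshold k j x.top p) x.top / x.top with hsdef
  have hs0 : 0 ≤ s := by positivity
  have hs1 : s ≤ 1 := (div_le_one hu).2 (min_le_right _ _)
  have hpow : s ^ (k + 1) ≤ 1 := pow_le_one₀ hs0 hs1
  rw [priceRevenue, hthr, hx.belief_Iio k hs ht, hx.belief_Ici k hs ht,
    ← ENNReal.ofReal_add hp (hrev _), ← ENNReal.ofReal_mul (sub_nonneg.2 hpow),
    ← ENNReal.ofReal_mul (by positivity), ← ENNReal.ofReal_add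
      (mul_nonneg (sub_nonneg.2 hpow) (add_nonneg hp (hrev _)))
      (mul_nonneg (by positivity) (hrev _))]
  congr 1
  simp only [revenue, State.step, hs, Bool.false_eq_true, if_false, if_true,
    (hx.of_not_sold hs).2, revenuePoly]
  change (1 - s ^ (k + 1)) * (p + j * min 1 p)
    + s ^ (k + 1) * (revenueRate k j * nextTop k j x.top p) = _
  rcases lt_or_ge (threshold k j x.top p) x.top with h | h
  · have hts : threshold k j x.top p = s * x.top := by
      rw [hsdef, min_eq_left h.le]
      field_simp
    have hK := threshold_of_lt h
    rw [min_eq_right (hle.trans (h.le.trans hx.top_le_one))]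
    -- At threshold `0` the top is unchanged rather than `s * top`, but rejection has weight zero.
    have hnext : s ^ (k + 1) * nextTop k j x.top p = s ^ (k + 1) * (s * x.top) := by
      rcases ht.eq_or_lt with h0 | h0
      · have : s = 0 := by
          rw [hsdef, ← h0, min_eq_left hu.le, zero_div]
        simp [this]
      · rw [nextTop, if_pos ⟨h0, h⟩, hts]
    rw [hts] at hK
    linear_combination (-(1 - s ^ (k + 1))) * hK + revenueRate k j * hnext
  · have : s = 1 := by rw [hsdef, min_eq_right h, div_self hu.ne']
    rw [this, nextTop, if_neg (by simp [h])]
    ring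

/-- A price up to the cap sells surely and becomes the new cap. A higher one exceeds `1` and merely
wastes the round. -/
theorem Valid.priceRevenue_of_sold {x : State} (hx : x.Valid) (k j : ℕ) (hs : x.sold = true)
    {p : ℝ} (hp : 0 ≤ p) (hc : min 1 p ≤ x.cap) :
    x.priceRevenue k j p
      = ENNReal.ofReal (if p ≤ x.cap then (j + 1) * p else j * x.cap) := by
  have hprob := hx.isProbabilityMeasure_belief k
  have hae := hx.belief_ae_response k j hs hc
  have h1 := measure_eq_one_of_ae_mem hae
  have h2 := (prob_compl_eq_zero_iff (measurableSet_responseSet _ _)).2 h1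
  rw [← responseSet_not] at h2
  unfold priceRevenue
  by_cases h : p ≤ x.cap
  · simp only [h, decide_true, Bool.not_true, responseSet] at h1 h2
    rw [h1, h2, if_pos h]
    simp only [State.step, revenue, hs, if_true]
    rw [zero_mul, add_zero, one_mul, ← ENNReal.ofReal_add hp]
    · congr 1
      change p + j * min x.cap p = _
      rw [min_eq_right h]
      ring
    · exact mul_nonneg (Nat.cast_nonneg j) (le_min hx.cap_nonneg hp)
  · simp only [h, decide_false, Bool.not_false, responseSet] at h1 h2
    rw [h1, h2, if_neg h]
    simp [State.step, revenue, hs, State.cap]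

theorem Valid.priceRevenue_le {x : State} (hx : x.Valid) (k j : ℕ) {p : ℝ} (hp : 0 ≤ p)
    (hc : min 1 p ≤ x.cap) : x.priceRevenue k j p ≤ ENNReal.ofReal (x.revenue k (j + 1)) := by
  have hu := hx.top_pos
  cases hs : x.sold
  · rw [hx.priceRevenue_of_not_sold k j hs hp]
    refine ENNReal.ofReal_le_ofReal ?_
    simp only [revenue, hs, Bool.false_eq_true, if_false]
    rw [mul_comm, revenueRate_succ]
    refine mul_le_mul_of_nonneg_right (revenuePoly_le_bestFraction k j _ _ ⟨?_, ?_⟩) hu.le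
    · have := hp.trans (le_threshold k j hu.le hp)
      positivity
    · exact (div_le_one hu).2 (min_le_right _ _)
  · rw [hx.priceRevenue_of_sold k j hs hp hc]
    refine ENNReal.ofReal_le_ofReal ?_
    have := hx.cap_nonneg
    simp only [revenue, hs, if_true]
    push_cast
    split_ifs with h
    · exact mul_le_mul_of_nonneg_left h (by positivity)
    · linarith

theorem Valid.priceRevenue_price {x : State} (hx : x.Valid) (k j : ℕ) :
    x.priceRevenue k j (x.price k (j + 1)) = ENNReal.ofReal (x.revenue k (j + 1)) := by
  have hu := hx.top_pos
  have hp := hx.price_nonneg k (j + 1)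
  cases hs : x.sold
  · rw [hx.priceRevenue_of_not_sold k j hs hp]
    simp only [revenue, price, hs, Bool.false_eq_true, if_false]
    rw [threshold_priceRate k j hu.le, min_eq_left
      (mul_le_of_le_one_left hu.le (thresholdRate_mem k j).2), mul_div_cancel_right₀ _ hu.ne',
      mul_comm, revenueRate_succ]
  · rw [hx.priceRevenue_of_sold k j hs hp
      ((min_le_right _ _).trans (hx.price_le_cap k (j + 1)))]
    simp [revenue, price, hs]

end State

/-! ### Backward induction for the seller -/

theorem measurable_extend (r : ℕ) (a : Bool) :
    Measurable fun x : Hist r × ℝ => x.1.extend x.2 a := by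
  refine measurable_pi_lambda _ fun i => ?_
  induction i using Fin.lastCases with
  | last =>
    simp only [Hist.extend, Fin.snoc_last]
    fun_prop
  | cast i =>
    simp only [Hist.extend, Fin.snoc_castSucc]
    fun_prop

theorem BuyerStrategy.measurable_respond (b : BuyerStrategy) (r : ℕ) (a : Bool) :
    Measurable fun x : ℝ × Hist r × ℝ => b.respond r x.1 x.2.1 x.2.2 a := by
  cases a
  · exact measurable_const.sub (b.measurable_accept r)
  · exact b.measurable_accept r

theorem measurable_expTotalAt_of {g : ℝ → ℝ≥0∞} (hg : Measurable g) (s : SellerStrategy)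
    (b : BuyerStrategy) (m r : ℕ)
    (h : Measurable fun x : ℝ × Hist (r + 1) => expTotal g s b x.1 m (r + 1) x.2) :
    Measurable fun x : ℝ × Hist r × ℝ => expTotalAt g s b x.1 m r x.2.1 x.2.2 := by
  have ht := b.measurable_respond r true
  have hf := b.measurable_respond r false
  have he : ∀ a, Measurable fun x : ℝ × Hist r × ℝ =>
      expTotal g s b x.1 m (r + 1) (x.2.1.extend x.2.2 a) := fun a =>
    h.comp (measurable_fst.prodMk ((measurable_extend r a).comp measurable_snd))
  exact (ht.mul ((hg.comp (by fun_prop)).add (he true))).add (hf.mul (he false))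

theorem measurable_expTotal {g : ℝ → ℝ≥0∞} (hg : Measurable g) (s : SellerStrategy)
    (b : BuyerStrategy) (m r : ℕ) :
    Measurable fun x : ℝ × Hist r => expTotal g s b x.1 m r x.2 := by
  induction m generalizing r with
  | zero => exact measurable_const
  | succ m ih =>
    have := s.isMarkov r
    have h := measurable_expTotalAt_of hg s b m r (ih (r + 1))
    exact Measurable.lintegral_kernel_prod_right'
      (κ := (s.price r).comap Prod.snd measurable_snd)
      (f := fun x : (ℝ × Hist r) × ℝ => expTotalAt g s b x.1.1 m r x.1.2 x.2)
      (h.comp (by fun_prop : Measurable fun x : (ℝ × Hist r) × ℝ => (x.1.1, x.1.2, x.2)))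

theorem measurable_expTotalAt {g : ℝ → ℝ≥0∞} (hg : Measurable g) (s : SellerStrategy)
    (b : BuyerStrategy) (m r : ℕ) :
    Measurable fun x : ℝ × Hist r × ℝ => expTotalAt g s b x.1 m r x.2.1 x.2.2 :=
  measurable_expTotalAt_of hg s b m r (measurable_expTotal hg s b m (r + 1))

theorem sellerUtility_succ (s : SellerStrategy) (b : BuyerStrategy) (μ : Measure ℝ) [SFinite μ]
    (m r : ℕ) (h : Hist r) :
    sellerUtility s b μ (m + 1) r h = ∫⁻ p, sellerUtilityAt s b μ m r h p ∂(s.price r h) := by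
  have := s.isMarkov r
  refine lintegral_lintegral_swap (f := fun v p => expTotalAt ENNReal.ofReal s b v m r h p) ?_
  exact ((measurable_expTotalAt ENNReal.measurable_ofReal s b m r).comp
    (by fun_prop : Measurable fun x : ℝ × ℝ => (x.1, h, x.2))).aemeasurable

/-- The seller's beliefs. -/
def beliefs (k n : ℕ) (r : ℕ) (h : Hist r) : Measure ℝ := (state k n r h).belief k

theorem beliefs_bayes (k n : ℕ) {r : ℕ} {h : Hist r} (hf : h.Feasible) {p : ℝ}
    (hp : p ∈ h.allowed) (a : Bool) {B : Set ℝ} (hB : MeasurableSet B) :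
    beliefs k n (r + 1) (h.extend p a) B * ∫⁻ v, (buyer k n).respond r v h p a ∂(beliefs k n r h)
      = ∫⁻ v in B, (buyer k n).respond r v h p a ∂(beliefs k n r h) := by
  simp only [respond_buyer, beliefs, state_extend]
  rw [lintegral_indicator_one (measurableSet_responseSet _ _),
    lintegral_indicator_one (measurableSet_responseSet _ _), Measure.restrict_apply' hB]
  exact (valid_state k n hf).belief_step k _ hp.1 (min_one_le_cap k n h hp) a B

/-- Bayes' rule as an identity of measures: the belief weighted by the response probability is the
total probability times the next belief. Continuations can thus be evaluated under updated beliefs.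
-/
theorem lintegral_respond_mul (k n : ℕ) {r : ℕ} {h : Hist r} (hf : h.Feasible) {p : ℝ}
    (hp : p ∈ h.allowed) (a : Bool) {G : ℝ → ℝ≥0∞} (hG : Measurable G) :
    ∫⁻ v, (buyer k n).respond r v h p a * G v ∂(beliefs k n r h)
      = beliefs k n r h (responseSet ((state k n r h).thr k (n - (r + 1)) p) a)
        * ∫⁻ v, G v ∂(beliefs k n (r + 1) (h.extend p a)) := by
  have hm : Measurable fun v => (buyer k n).respond r v h p a :=
    ((buyer k n).measurable_respond r a).comp
      (by fun_prop : Measurable fun v : ℝ => (v, h, p))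
  have hS : ∫⁻ v, (buyer k n).respond r v h p a ∂(beliefs k n r h)
      = beliefs k n r h (responseSet ((state k n r h).thr k (n - (r + 1)) p) a) := by
    simp only [respond_buyer]
    exact lintegral_indicator_one (measurableSet_responseSet _ _)
  have hden : (beliefs k n r h).withDensity (fun v => (buyer k n).respond r v h p a)
      = beliefs k n r h (responseSet ((state k n r h).thr k (n - (r + 1)) p) a)
        • beliefs k n (r + 1) (h.extend p a) := by
    ext B hB
    rw [withDensity_apply _ hB, ← beliefs_bayes k n hf hp a hB, hS, Measure.smul_apply,
      smul_eq_mul, mul_comm]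
  rw [← smul_eq_mul, ← lintegral_smul_measure, ← hden,
    lintegral_withDensity_eq_lintegral_mul _ hm hG]
  rfl

theorem isProbabilityMeasure_beliefs (k n : ℕ) {r : ℕ} {h : Hist r} (hf : h.Feasible) :
    IsProbabilityMeasure (beliefs k n r h) :=
  (valid_state k n hf).isProbabilityMeasure_belief k

theorem sellerUtilityAt_buyer (k n : ℕ) (s : SellerStrategy) (m : ℕ) {r : ℕ} {h : Hist r}
    (hf : h.Feasible) {p : ℝ} (hp : p ∈ h.allowed) :
    sellerUtilityAt s (buyer k n) (beliefs k n r h) m r h p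
      = beliefs k n r h (Set.Ici ((state k n r h).thr k (n - (r + 1)) p))
          * (ENNReal.ofReal p + sellerUtility s (buyer k n)
            (beliefs k n (r + 1) (h.extend p true)) m (r + 1) (h.extend p true))
        + beliefs k n r h (Set.Iio ((state k n r h).thr k (n - (r + 1)) p))
          * sellerUtility s (buyer k n)
            (beliefs k n (r + 1) (h.extend p false)) m (r + 1) (h.extend p false) := by
  have he : ∀ a, Measurable fun v =>
      expTotal ENNReal.ofReal s (buyer k n) v m (r + 1) (h.extend p a) := fun a =>
    (measurable_expTotal ENNReal.measurable_ofReal s (buyer k n) m (r + 1)).comp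
      (by fun_prop : Measurable fun v : ℝ => (v, h.extend p a))
  have hm : ∀ a, Measurable fun v => (buyer k n).respond r v h p a := fun a =>
    ((buyer k n).measurable_respond r a).comp
      (by fun_prop : Measurable fun v : ℝ => (v, h, p))
  have := isProbabilityMeasure_beliefs k n (hf.extend hp true)
  have hmul : Measurable fun v => (buyer k n).respond r v h p false *
      expTotal ENNReal.ofReal s (buyer k n) v m (r + 1) (h.extend p false) :=
    (hm false).mul (he false)
  unfold sellerUtilityAt expTotalAt
  rw [lintegral_add_right _ hmul,
    lintegral_respond_mul k n hf hp true (G := fun v => ENNReal.ofReal p +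
      expTotal ENNReal.ofReal s (buyer k n) v m (r + 1) (h.extend p true))
      (measurable_const.add (he true)),
    lintegral_respond_mul k n hf hp false (he false), lintegral_add_left measurable_const,
    lintegral_const, measure_univ, mul_one]
  rfl

/-- No strategy of the seller yields more than the equilibrium revenue. -/
theorem sellerUtility_le (k n : ℕ) (s : SellerStrategy) (m : ℕ) {r : ℕ} (hr : r + m = n)
    {h : Hist r} (hf : h.Feasible) :
    sellerUtility s (buyer k n) (beliefs k n r h) m r h
      ≤ ENNReal.ofReal ((state k n r h).revenue k m) := by
  induction m generalizing r with
  | zero => simp [sellerUtility, expTotal]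
  | succ m ih =>
    have := isProbabilityMeasure_beliefs k n hf
    have := s.isMarkov r
    have hm : n - (r + 1) = m := by omega
    rw [sellerUtility_succ]
    calc ∫⁻ p, sellerUtilityAt s (buyer k n) (beliefs k n r h) m r h p ∂(s.price r h)
        ≤ ∫⁻ _, ENNReal.ofReal ((state k n r h).revenue k (m + 1)) ∂(s.price r h) := by
          refine lintegral_mono_ae ?_
          filter_upwards [s.allowed r h hf] with p hp
          refine le_trans ?_ ((valid_state k n hf).priceRevenue_le k m hp.1
            (min_one_le_cap k n h hp))
          have h1 := ih (by omega) (hf.extend hp true)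
          have h2 := ih (by omega) (hf.extend hp false)
          rw [sellerUtilityAt_buyer k n s m hf hp]
          rw [state_extend, hm] at h1 h2
          rw [hm]
          unfold State.priceRevenue beliefs at *
          gcongr
      _ = _ := by simp

theorem lintegral_seller (k n : ℕ) {r : ℕ} (h : Hist r) (f : ℝ → ℝ≥0∞) :
    ∫⁻ p, f p ∂((seller k n).price r h) = f ((state k n r h).price k (n - r)) := by
  have : (seller k n).price r h = Measure.dirac ((state k n r h).price k (n - r)) :=
    Kernel.deterministic_apply ((measurable_price k (n - r)).comp (measurable_state k n r)) h
  rw [this, lintegral_dirac]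

theorem sellerUtility_seller (k n m : ℕ) {r : ℕ} (hr : r + m = n) {h : Hist r}
    (hf : h.Feasible) :
    sellerUtility (seller k n) (buyer k n) (beliefs k n r h) m r h
      = ENNReal.ofReal ((state k n r h).revenue k m) := by
  induction m generalizing r with
  | zero =>
    have : (state k n r h).revenue k 0 = 0 := by
      simp [State.revenue, revenueRate, rates]
    simp [sellerUtility, expTotal, this]
  | succ m ih =>
    have := isProbabilityMeasure_beliefs k n hf
    have hm : n - (r + 1) = m := by omega
    have hp := price_mem_allowed k n (m + 1) hf
    rw [sellerUtility_succ, lintegral_seller, show n - r = m + 1 by omega,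
      sellerUtilityAt_buyer k n _ m hf hp, ih (by omega) (hf.extend hp true),
      ih (by omega) (hf.extend hp false), state_extend, state_extend, hm,
      ← (valid_state k n hf).priceRevenue_price k m]
    rfl

theorem sellerUtilityAt_le (k n m : ℕ) {r : ℕ} (hr : r + (m + 1) = n) {h : Hist r}
    (hf : h.Feasible) {p : ℝ} (hp : p ∈ h.allowed) (s : SellerStrategy) :
    sellerUtilityAt s (buyer k n) (beliefs k n r h) m r h p
      ≤ sellerUtilityAt (seller k n) (buyer k n) (beliefs k n r h) m r h p := by
  have hle : ∀ a, sellerUtility s (buyer k n) (beliefs k n (r + 1) (h.extend p a)) m (r + 1)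
      (h.extend p a) ≤ sellerUtility (seller k n) (buyer k n)
      (beliefs k n (r + 1) (h.extend p a)) m (r + 1) (h.extend p a) := fun a => by
    rw [sellerUtility_seller k n m (by omega) (hf.extend hp a)]
    exact sellerUtility_le k n s m (by omega) (hf.extend hp a)
  rw [sellerUtilityAt_buyer k n _ m hf hp, sellerUtilityAt_buyer k n _ m hf hp]
  have := hle true
  have := hle false
  gcongr

/-! ### Backward induction for the buyer -/

/-- The equilibrium utility of a buyer of value `v` after the price `p` has been posted. -/
def State.utilityAt (k j : ℕ) (x : State) (v p : ℝ) : ℝ :=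
  max (v - p + (x.step k j (p, true)).utility k j v) ((x.step k j (p, false)).utility k j v)

theorem State.utilityAt_nonneg (k j : ℕ) (x : State) (v p : ℝ) : 0 ≤ x.utilityAt k j v p :=
  le_max_of_le_right (utility_nonneg ..)

/-- Moving payments to the right avoids subtraction in `ℝ≥0∞`. A mixed response averages the bounds
for the two pure ones. -/
theorem expTotalAt_le (k n m : ℕ) {r : ℕ} (hm : n - (r + 1) = m) (h : Hist r) (p : ℝ) {v : ℝ}
    (hp : 0 ≤ p) (hv : 0 ≤ v) (b : BuyerStrategy)
    (ih : ∀ a, ENNReal.ofReal v * expTotal (fun _ => 1) (seller k n) b v m (r + 1) (h.extend p a)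
      ≤ ENNReal.ofReal ((state k n (r + 1) (h.extend p a)).utility k m v)
        + expTotal ENNReal.ofReal (seller k n) b v m (r + 1) (h.extend p a)) :
    ENNReal.ofReal v * expTotalAt (fun _ => 1) (seller k n) b v m r h p
      ≤ ENNReal.ofReal ((state k n r h).utilityAt k m v p)
        + expTotalAt ENNReal.ofReal (seller k n) b v m r h p := by
  have h1 := ih true
  have h2 := ih false
  rw [state_extend, hm] at h1 h2
  have hsum : b.respond r v h p true + b.respond r v h p false = 1 :=
    add_tsub_cancel_of_le (b.accept_le_one r v h p)
  set x := state k n r h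
  have hx1 : ENNReal.ofReal v + ENNReal.ofReal ((x.step k m (p, true)).utility k m v)
      ≤ ENNReal.ofReal (x.utilityAt k m v p) + ENNReal.ofReal p := by
    rw [← ENNReal.ofReal_add hv (State.utility_nonneg ..),
      ← ENNReal.ofReal_add (State.utilityAt_nonneg ..) hp]
    refine ENNReal.ofReal_le_ofReal ?_
    have : v - p + (x.step k m (p, true)).utility k m v ≤ x.utilityAt k m v p := le_max_left _ _
    linarith
  have hx2 : ENNReal.ofReal ((x.step k m (p, false)).utility k m v)
      ≤ ENNReal.ofReal (x.utilityAt k m v p) :=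
    ENNReal.ofReal_le_ofReal (le_max_right _ _)
  unfold expTotalAt
  generalize b.respond r v h p true = α at *
  generalize b.respond r v h p false = β at *
  generalize expTotal (fun _ => 1) (seller k n) b v m (r + 1) (h.extend p true) = n₁ at *
  generalize expTotal (fun _ => 1) (seller k n) b v m (r + 1) (h.extend p false) = n₂ at *
  generalize expTotal ENNReal.ofReal (seller k n) b v m (r + 1) (h.extend p true) = c₁ at *
  generalize expTotal ENNReal.ofReal (seller k n) b v m (r + 1) (h.extend p false) = c₂ at *
  generalize ENNReal.ofReal (x.utilityAt k m v p) = W at *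
  have h3 : ENNReal.ofReal v + ENNReal.ofReal v * n₁ ≤ W + ENNReal.ofReal p + c₁ := by
    refine (add_le_add le_rfl h1).trans ?_
    rw [← add_assoc]
    gcongr
  have h4 : ENNReal.ofReal v * n₂ ≤ W + c₂ := h2.trans (by gcongr)
  calc ENNReal.ofReal v * (α * (1 + n₁) + β * n₂)
      = α * (ENNReal.ofReal v + ENNReal.ofReal v * n₁) + β * (ENNReal.ofReal v * n₂) := by ring
    _ ≤ α * (W + ENNReal.ofReal p + c₁) + β * (W + c₂) := by
      gcongr
    _ = (α + β) * W + (α * (ENNReal.ofReal p + c₁) + β * c₂) := by ring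
    _ = _ := by rw [hsum, one_mul]

/-- No strategy of the buyer yields more than the equilibrium utility. -/
theorem expTotal_le (k n m : ℕ) {r : ℕ} (hr : r + m = n) {h : Hist r} (hf : h.Feasible) {v : ℝ}
    (hv : 0 ≤ v) (b : BuyerStrategy) :
    ENNReal.ofReal v * expTotal (fun _ => 1) (seller k n) b v m r h
      ≤ ENNReal.ofReal ((state k n r h).utility k m v)
        + expTotal ENNReal.ofReal (seller k n) b v m r h := by
  induction m generalizing r with
  | zero => simp [expTotal]
  | succ m ih =>
    have hp := price_mem_allowed k n (m + 1) hf
    have := expTotalAt_le k n m (by omega) h _ hp.1 hv b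
      fun a => ih (by omega) (hf.extend hp a)
    rw [State.utilityAt, ← (valid_state k n hf).utility_succ k m] at this
    simp only [expTotal]
    rw [lintegral_seller, lintegral_seller, show n - r = m + 1 by omega]
    exact this

/-- The threshold selects the larger branch of `utilityAt`, giving equality in the bound. Finiteness
of the payments is carried along so that they can be subtracted in `EReal`. -/
theorem expTotalAt_buyer (k n m : ℕ) {r : ℕ} (hm : n - (r + 1) = m) {h : Hist r}
    (hf : h.Feasible) {p v : ℝ} (hp : p ∈ h.allowed) (hv : v ∈ valueSpace)
    (ih : ∀ a, expTotal ENNReal.ofReal (seller k n) (buyer k n) v m (r + 1) (h.extend p a) ≠ ⊤ ∧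
      ENNReal.ofReal v
          * expTotal (fun _ => 1) (seller k n) (buyer k n) v m (r + 1) (h.extend p a)
        = ENNReal.ofReal ((state k n (r + 1) (h.extend p a)).utility k m v)
          + expTotal ENNReal.ofReal (seller k n) (buyer k n) v m (r + 1) (h.extend p a)) :
    expTotalAt ENNReal.ofReal (seller k n) (buyer k n) v m r h p ≠ ⊤ ∧
      ENNReal.ofReal v * expTotalAt (fun _ => 1) (seller k n) (buyer k n) v m r h p
        = ENNReal.ofReal ((state k n r h).utilityAt k m v p)
          + expTotalAt ENNReal.ofReal (seller k n) (buyer k n) v m r h p := by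
  obtain ⟨f1, h1⟩ := ih true
  obtain ⟨f2, h2⟩ := ih false
  have hx := valid_state k n hf
  have hc := min_one_le_cap k n h hp
  rw [state_extend, hm] at h1 h2
  unfold expTotalAt
  simp only [respond_buyer, hm]
  by_cases ht : (state k n r h).thr k m p ≤ v
  · simp only [responseSet, Set.indicator, Set.mem_Ici, Set.mem_Iio, ht, not_lt.2 ht, if_true,
      if_false, Pi.one_apply, one_mul, zero_mul, add_zero]
    refine ⟨ENNReal.add_ne_top.2 ⟨ENNReal.ofReal_ne_top, f1⟩, ?_⟩
    rw [mul_add, mul_one, h1, ← add_assoc, ← add_assoc,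
      ← ENNReal.ofReal_add hv.1 (State.utility_nonneg ..),
      ← ENNReal.ofReal_add (State.utilityAt_nonneg ..) hp.1, State.utilityAt,
      max_eq_left (hx.utility_reject_le k m hp.1 hc ht hv.2)]
    congr 2
    ring
  · simp only [responseSet, Set.indicator, Set.mem_Ici, Set.mem_Iio, ht, not_le.1 ht, if_true,
      if_false, Pi.one_apply, one_mul, zero_mul, zero_add]
    refine ⟨f2, ?_⟩
    rw [h2, State.utilityAt, max_eq_right (hx.utility_accept_le k m hp.1 (not_le.1 ht) hv.2)]

theorem expTotal_buyer (k n m : ℕ) {r : ℕ} (hr : r + m = n) {h : Hist r} (hf : h.Feasible)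
    {v : ℝ} (hv : v ∈ valueSpace) :
    expTotal ENNReal.ofReal (seller k n) (buyer k n) v m r h ≠ ⊤ ∧
      ENNReal.ofReal v * expTotal (fun _ => 1) (seller k n) (buyer k n) v m r h
        = ENNReal.ofReal ((state k n r h).utility k m v)
          + expTotal ENNReal.ofReal (seller k n) (buyer k n) v m r h := by
  induction m generalizing r with
  | zero => simp [expTotal, State.utility, waitingValue]
  | succ m ih =>
    have hp := price_mem_allowed k n (m + 1) hf
    have := expTotalAt_buyer k n m (by omega) hf hp hv
      fun a => ih (by omega) (hf.extend hp a)
    rw [State.utilityAt, ← (valid_state k n hf).utility_succ k m] at this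
    simp only [expTotal]
    rw [lintegral_seller, lintegral_seller, show n - r = m + 1 by omega]
    exact this

theorem coe_sub_coe_le {A B A' B' W : ℝ≥0∞} (h : A ≤ W + B) (hB : B' ≠ ⊤) (h' : A' = W + B') :
    (A : EReal) - B ≤ (A' : EReal) - B' := by
  have h1 : (A' : EReal) - B' = W := by
    lift B' to NNReal using hB
    rw [h', EReal.coe_ennreal_add, EReal.coe_nnreal_eq_coe_real, EReal.add_sub_cancel_right]
  rw [h1]
  exact EReal.sub_le_of_le_add (by rw [← EReal.coe_ennreal_add]; exact_mod_cast h)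

theorem isPBE (k n : ℕ) : IsPBE n (powerLaw k) (seller k n) (buyer k n) (beliefs k n) where
  belief_prob _ _ _ hf := isProbabilityMeasure_beliefs k n hf
  belief_support _ _ _ _ := State.belief_ae_mem_valueSpace k _
  prior _ := State.belief_initial k
  bayes _ _ _ hf _ hp a _ hB := beliefs_bayes k n hf hp a hB
  seller_opt r m hr h hf s := by
    rw [sellerUtility_seller k n m hr hf]
    exact sellerUtility_le k n s m hr hf
  seller_opt_at r m hr h hf p hp s := sellerUtilityAt_le k n m hr hf hp s
  buyer_opt r m hr h hf v hv b :=
    coe_sub_coe_le (expTotal_le k n m hr hf hv.1 b) (expTotal_buyer k n m hr hf hv).1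
      (expTotal_buyer k n m hr hf hv).2
  buyer_opt_at r m hr h hf p hp v hv b := by
    have hm : n - (r + 1) = m := by omega
    have h1 := expTotalAt_le k n m hm h p hp.1 hv.1 b
      fun a => expTotal_le k n m (by omega) (hf.extend hp a) hv.1 b
    have h2 := expTotalAt_buyer k n m hm hf hp hv
      fun a => expTotal_buyer k n m (by omega) (hf.extend hp a) hv
    exact coe_sub_coe_le h1 h2.1 h2.2

end

end RepeatedSales

theorem theorem2 (k n : ℕ) :
    ∃ (s : RepeatedSales.SellerStrategy) (b : RepeatedSales.BuyerStrategy)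
      (μ : ∀ r : ℕ, RepeatedSales.Hist r → MeasureTheory.Measure ℝ),
      RepeatedSales.IsPBE n (RepeatedSales.powerLaw k) s b μ ∧ b.IsThreshold n :=
  ⟨RepeatedSales.seller k n, RepeatedSales.buyer k n, RepeatedSales.beliefs k n,
    RepeatedSales.isPBE k n, RepeatedSales.isThreshold_buyer k n⟩
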